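/- Let $R_c>0$, $\delta\ge 2R_c$, and let $\Phi_p$ be a stationary hard-core point process in $\mathbb{R}^2$ of intensity $\lambda_p>0$ (finite) and clearance $\delta$, i.e. any two of its points are at distance at least $\delta$; its points are the cluster centres. Let $\tilde\Phi=\{(x,\mathbf m_x):x\in\Phi_p\}$ be an independently marked version of $\Phi_p$: the marks are i.i.d. and independent of $\Phi_p$. The mark $\mathbf m_x$ describes the users of the cluster at $x$: - a Poisson number $N_{x,u}$, of mean $\lambda_u\pi R_c^2$, of caching users, with i.i.d. uniform positions in the disc of radius $R_c$ (relative to $x$), each caching $M$ videos drawn independently from a distribution $p_A$ on $\{1,\dots,L\}$; - independently, a Poisson number $N_{x,r}$, of mean $\lambda_r\pi R_c^2$, of requesting users, with i.i.d. uniform positions $D_{x,i}$ in the disc of radius $R_c$ (relative to $x$), each requesting a video $V_{x,i}$ drawn independently from a distribution $p_V$ on $\{1,\dots,L\}$; - a family of non-negative power fading coefficients, whose conditional law given all the above depends only on the numbers and positions of the users (an arbitrary probability kernel); - an independent uniform variable, available to the strategy for random selections. An in-cluster communication strategy $\mathcal F$, the same for all clusters, assigns measurably to the mark $\mathbf m_x$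 a set of scheduled requesting users, and to $\mathbf m_x$ together with the network $\tilde\Phi$ as seen from $x$ (all centres translated by $-x$) a rate region in $\mathbb{R}_+^{N_{x,r}}$. Fix an attempted rate $R\ge 0$. The request of user $i$ of the cluster at $x$ is served (event $\mathcal S_{x,i}$) if the video $V_{x,i}$ is cached by some caching user of that cluster, user $i$ is scheduled, and $R$ occurs as the $i$-th rate in the rate region. For $K\subset\mathbb{R}^2$ put $$N_s(K)=\sum_{x\in\Phi_p}\sum_{i=1}^{N_{x,r}}\mathbf 1\{x+D_{x,i}\in K\}\,\mathbf 1_{\mathcal S_{x,i}},\qquad N_{sc}(x)=\sum_{i=1}^{N_{x,r}}\mathbf 1_{\mathcal S_{x,i}}\quad(x\in\Phi_p).$$ Let $\mathbb{E}^0$ be the expectation with respect to the Palm distribution of $\tilde\Phi$ at the origin, i.e. the law $$\mathbb P^0(A)=\frac1{\lambda_p}\,\mathbb E\big[\#\{x\in\Phi_p\cap[0,1)^2:\ \tilde\Phi\text{ seen from }x\text{ belongs to }A\}\big].$$ Then for every compact set $K\subset\mathbb{R}^2$, with $|K|$ its area, $$\mathbb E[N_s(K)]=\lambda_p\,|K|\,\mathbb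 E^0[N_{sc}(0)].$$ Moreover $\mathbb E^0[N_{sc}(0)]$ is the average number of requests served per cluster of the network: for every Borel set $B\subset\mathbb{R}^2$ with $0<|B|<\infty$, $$\frac{\mathbb E\big[\sum_{x\in\Phi_p\cap B}N_{sc}(x)\big]}{\mathbb E[\#(\Phi_p\cap B)]}=\mathbb E^0[N_{sc}(0)].$$ -/

import Mathlib

open MeasureTheory ProbabilityTheory
open scoped NNReal ENNReal

namespace D2D

noncomputable section

/-- The Euclidean plane. -/
abbrev Plane := EuclideanSpace ℝ (Fin 2)

/-! ### Marks: the users of one cluster -/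

/-- The caching users of a cluster: their number, and for each of them the position relative to
the cluster centre and the `M` cached videos (from a library of `L` videos). -/
abbrev CacheConfig (M L : ℕ) := Σ n : ℕ, Fin n → Plane × (Fin M → Fin L)

/-- The requesting users of a cluster: their number, and for each of them the position relative
to the cluster centre and the requested video. -/
abbrev RequestConfig (L : ℕ) := Σ n : ℕ, Fin n → Plane × Fin L

/-- The numbers and relative positions of the caching and of the requesting users of a cluster. -/
abbrev Positions := (Σ n : ℕ, Fin n → Plane) × (Σ n : ℕ, Fin n → Plane)

/-- The mark of a cluster: caching users, requesting users, a family (indexed by `ι`) of power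
fading coefficients between users of the cluster and towards users of other clusters, and a
uniform variable that a strategy may use for random selections. -/
abbrev Mark (M L : ℕ) (ι : Type*) :=
  ((CacheConfig M L × RequestConfig L) × (ι → ℝ≥0)) × unitInterval

section Mark

variable {M L : ℕ} {ι : Type*}

/-- Number of caching users in the cluster. -/
def numCache (m : Mark M L ι) : ℕ := m.1.1.1.1

/-- Number of requesting users in the cluster. -/
def numReq (m : Mark M L ι) : ℕ := m.1.1.2.1

/-- The videos cached by the `j`-th caching user. -/
def cached (m : Mark M L ι) (j : Fin (numCache m)) : Fin M → Fin L := (m.1.1.1.2 j).2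

/-- The position, relative to the cluster centre, of the `i`-th requesting user. -/
def reqPos (m : Mark M L ι) (i : Fin (numReq m)) : Plane := (m.1.1.2.2 i).1

/-- The video requested by the `i`-th requesting user. -/
def reqVideo (m : Mark M L ι) (i : Fin (numReq m)) : Fin L := (m.1.1.2.2 i).2

end Mark

/-- The numbers and relative positions of all users of a cluster. -/
def positions {M L : ℕ} (c : CacheConfig M L × RequestConfig L) : Positions :=
  (⟨c.1.1, fun i => (c.1.2 i).1⟩, ⟨c.2.1, fun i => (c.2.2 i).1⟩)

theorem measurable_sigma_positions {β : Type*} [MeasurableSpace β] :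
    Measurable (fun s : (Σ n : ℕ, Fin n → Plane × β) =>
      (⟨s.1, fun i => (s.2 i).1⟩ : Σ n : ℕ, Fin n → Plane)) := by
  intro t ht
  rw [MeasurableSpace.measurableSet_iInf] at ht ⊢
  intro n
  have h := ht n
  have hf : Measurable (fun (f : Fin n → Plane × β) (i : Fin n) => (f i).1) := by fun_prop
  exact hf h

theorem measurable_positions {M L : ℕ} : Measurable (positions (M := M) (L := L)) :=
  (measurable_sigma_positions.comp measurable_fst).prodMk
    (measurable_sigma_positions.comp measurable_snd)

/-- The uniform distribution on the disc of radius `Rc` about the origin. -/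
def uniformDisc (Rc : ℝ≥0) : Measure Plane :=
  cond volume (Metric.closedBall (0 : Plane) Rc)

/-- Law of a Poisson number (of mean `lam * π * Rc ^ 2`) of users with i.i.d. uniform positions in
the disc of radius `Rc` and i.i.d. labels of law `q`, independent of the positions. -/
def userLaw {β : Type*} [MeasurableSpace β] (lam Rc : ℝ≥0) (q : Measure β) :
    Measure (Σ n : ℕ, Fin n → Plane × β) :=
  (poissonMeasure (lam * NNReal.pi * Rc ^ 2)).bind fun n =>
    (Measure.pi fun _ : Fin n => (uniformDisc Rc).prod q).map (Sigma.mk n)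

/-- The law of the mark of a cluster. Caching users (intensity `lamU`, with `M` cached videos each,
drawn independently from `pA`) and requesting users (intensity `lamR`, with a request drawn from
`pV`) are independent; given these, the fading coefficients have the conditional law
`fading`, which depends only on the numbers and positions of the users. -/
def markLaw {M L : ℕ} {ι : Type*} (lamU lamR Rc : ℝ≥0) (pA pV : PMF (Fin L))
    (fading : Kernel Positions (ι → ℝ≥0)) : Measure (Mark M L ι) :=
  (((userLaw lamU Rc (Measure.pi fun _ : Fin M => pA.toMeasure)).prod
      (userLaw lamR Rc pV.toMeasure)) ⊗ₘ
    (fading.comap positions measurable_positions)).prod (volume : Measure unitInterval)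

/-! ### Point processes of cluster centres, and the marked process -/

/-- The half-open unit square. -/
def unitSquare : Set Plane := {x | ∀ i, x i ∈ Set.Ico (0 : ℝ) 1}

/-- The point configuration formed by the first `k` (possibly `k = ∞`) terms of a sequence, as a
counting measure. -/
def configOf {α : Type*} [MeasurableSpace α] (k : ℕ∞) (a : ℕ → α) : Measure α :=
  open Classical in
  Measure.sum fun n : ℕ => if (n : ℕ∞) < k then Measure.dirac (a n) else 0

/-- A stationary hard-core point process in the plane, of clearance `δ` and intensity
`lam > 0`, on the probability space `(Ω, P)`; its points are `center n ω` for `n < count ω`. -/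
structure ParentPP {Ω : Type*} [MeasurableSpace Ω] (P : Measure Ω) (δ : ℝ) (lam : ℝ≥0) where
  count : Ω → ℕ∞
  center : ℕ → Ω → Plane
  measurable_count : Measurable count
  measurable_center : ∀ n, Measurable (center n)
  /-- distinct points are at distance at least `δ` -/
  hardCore : ∀ᵐ ω ∂P, ∀ i j : ℕ, (i : ℕ∞) < count ω → (j : ℕ∞) < count ω → i ≠ j →
    δ ≤ dist (center i ω) (center j ω)
  /-- the law of the point process is invariant under translations -/
  stationary : ∀ v : Plane,
    P.map (fun ω => (configOf (count ω) fun n => center n ω).map fun x => x + v) =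
      P.map (fun ω => configOf (count ω) fun n => center n ω)
  /-- the mean number of points in the unit square is `lam` -/
  intensity : ∫⁻ ω, configOf (count ω) (fun n => center n ω) unitSquare ∂P = lam
  intensity_pos : 0 < lam

/-- The point process of cluster centres as a random counting measure. -/
def ParentPP.points {Ω : Type*} [MeasurableSpace Ω] {P : Measure Ω} {δ : ℝ} {lam : ℝ≥0}
    (Φp : ParentPP P δ lam) (ω : Ω) : Measure Plane :=
  configOf (Φp.count ω) fun n => Φp.center n ω

/-- An independent marking of a point process: i.i.d. marks with law `μ`, independent of the
point process, are attached to its points. -/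
structure IndependentMarking {Ω : Type*} [MeasurableSpace Ω] {P : Measure Ω} {δ : ℝ} {lam : ℝ≥0}
    (Φp : ParentPP P δ lam) {𝓜 : Type*} [MeasurableSpace 𝓜] (μ : Measure 𝓜) where
  mark : ℕ → Ω → 𝓜
  measurable_mark : ∀ n, Measurable (mark n)
  law : ∀ n, P.map (mark n) = μ
  indep : iIndepFun mark P
  indep_points : IndepFun (fun ω n => mark n ω) (fun ω => (Φp.count ω, fun n => Φp.center n ω)) P

/-- Realisations of a marked point process, as counting measures on pairs (point, mark). -/
abbrev Network (𝓜 : Type*) [MeasurableSpace 𝓜] := Measure (Plane × 𝓜)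

/-- The marked point process `{(x, m_x)}` as a random counting measure. -/
def IndependentMarking.network {Ω : Type*} [MeasurableSpace Ω] {P : Measure Ω} {δ : ℝ} {lam : ℝ≥0}
    {Φp : ParentPP P δ lam} {𝓜 : Type*} [MeasurableSpace 𝓜] {μ : Measure 𝓜}
    (Φ : IndependentMarking Φp μ) (ω : Ω) : Network 𝓜 :=
  configOf (Φp.count ω) fun n => (Φp.center n ω, Φ.mark n ω)

/-- The network seen from `x`: all points are translated by `-x` and keep their marks. -/
def seenFrom {𝓜 : Type*} [MeasurableSpace 𝓜] (x : Plane) (φ : Network 𝓜) : Network 𝓜 :=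
  φ.map fun p => (p.1 - x, p.2)

/-- Every bounded set contains finitely many points of the network. -/
def FinitePointsInBounded {𝓜 : Type*} [MeasurableSpace 𝓜] (φ : Network 𝓜) : Prop :=
  ∀ r : ℝ, φ (Metric.closedBall (0 : Plane) r ×ˢ Set.univ) < ∞

/-- The Palm distribution (at the origin) of a stationary marked point process `Φ` of intensity
`lam`: the measure `A ↦ lam⁻¹ * E [#{x ∈ Φ ∩ unit square : Φ seen from x belongs to A}]`. -/
def palm {Ω : Type*} [MeasurableSpace Ω] {𝓜 : Type*} [MeasurableSpace 𝓜] (P : Measure Ω)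
    (Φ : Ω → Network 𝓜) (lam : ℝ≥0) : Measure (Network 𝓜) :=
  (lam : ℝ≥0∞)⁻¹ • P.bind fun ω =>
    ((Φ ω).restrict (unitSquare ×ˢ Set.univ)).map fun p => seenFrom p.1 (Φ ω)

/-! ### Strategies and served requests -/

section Strategy

variable {M L : ℕ} {ι : Type*}

/-- The video requested by user `i` is cached by some caching user of the cluster. -/
def Matched (m : Mark M L ι) (i : Fin (numReq m)) : Prop :=
  ∃ j : Fin (numCache m), ∃ k : Fin M, cached m j k = reqVideo m i

/-- The rate `R` occurs as the `i`-th rate in the rate region `A`. -/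
def RateIn {n : ℕ} (A : Set (Fin n → ℝ≥0)) (i : Fin n) (R : ℝ≥0) : Prop :=
  ∃ ρ ∈ A, ρ i = R

/-- An in-cluster communication strategy. All clusters use the same strategy: in a cluster with
mark `m`, it schedules transmissions to the users `i ∈ scheduled m`, and the rate region that
it guarantees is `region m φ`, where `φ` is the network seen from the centre of the cluster.
Scheduling a transmission and achieving a rate have to be events (measurable sets). -/
structure InClusterStrategy (M L : ℕ) (ι : Type*) where
  scheduled : (m : Mark M L ι) → Set (Fin (numReq m))
  region : (m : Mark M L ι) → Network (Mark M L ι) → Set (Fin (numReq m) → ℝ≥0)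
  measurable_scheduled : ∀ i : ℕ, MeasurableSet
    {m : Mark M L ι | ∃ h : i < numReq m, (⟨i, h⟩ : Fin (numReq m)) ∈ scheduled m}
  measurable_region : ∀ (i : ℕ) (R : ℝ≥0), MeasurableSet
    {q : Mark M L ι × Network (Mark M L ι) | FinitePointsInBounded q.2 ∧
      ∃ h : i < numReq q.1, RateIn (region q.1 q.2) ⟨i, h⟩ R}

/-- The request of user `i`, in a cluster with mark `m` from whose centre the network is seen as
`φ`, is served under the strategy `F` at attempted rate `R`. -/
def Served (F : InClusterStrategy M L ι) (R : ℝ≥0) (m : Mark M L ι) (φ : Network (Mark M L ι))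
    (i : Fin (numReq m)) : Prop :=
  Matched m i ∧ i ∈ F.scheduled m ∧ RateIn (F.region m φ) i R

/-- The number of served requests in `K`: the sum over the clusters `p = (x, m)` of the network,
and over the requesting users `i` of the cluster, of the indicator that user `i` lies in `K` and is
served. -/
def servedIn (F : InClusterStrategy M L ι) (R : ℝ≥0) (K : Set Plane)
    (φ : Network (Mark M L ι)) : ℝ≥0∞ :=
  open Classical in
  ∫⁻ p, ∑ i : Fin (numReq p.2),
    (if p.1 + reqPos p.2 i ∈ K ∧ Served F R p.2 (seenFrom p.1 φ) i then 1 else 0) ∂φ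

/-- The number of served requests in the cluster of the network `φ` that is centred at `x`
(the integral picks out the point `(x, m)` of `φ`). -/
def servedInCluster (F : InClusterStrategy M L ι) (R : ℝ≥0) (x : Plane)
    (φ : Network (Mark M L ι)) : ℝ≥0∞ :=
  open Classical in
  ∫⁻ p in {x} ×ˢ Set.univ, ∑ i : Fin (numReq p.2),
    (if Served F R p.2 (seenFrom x φ) i then 1 else 0) ∂φ

end Strategy

end

end D2D

/-!
Both identities are instances of the refined Campbell theorem for the marked process. The Campbell
measure `campbell` on triples (location, mark, network seen from the location) is invariant under
translations of the location (`map_add_campbell`) and gives finite mass to the unit square.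
By uniqueness of Haar measure it is the product of Lebesgue measure and of `markedPalm`, whose second
marginal is `lam` times the Palm distribution (`campbell_eq_prod`, `palm_eq`). Integrating the number
of served requests in `K` against this product, the integral over the location of the centre turns
the indicator that a given user lies in `K` into `volume K`, whatever the position of the user
relative to the centre (`lintegral_servedCount`). The average over the clusters centred in `B` is
obtained in the same way from the indicator of `B`. By the hard-core property a centre carries only
one mark, so that the integral in `servedInCluster` picks out a single cluster. Of the law of
the marks it matters only that it is a probability measure.

Translation invariance rests on the stationarity of the marked network
(`lintegral_translate_network_eq`), whereas only the law of the unmarked configuration of centres is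
assumed to be stationary. The marks are attached to the terms of an arbitrary enumeration of the
centres, so it has to be shown that the law of the marked network depends only on the law of the
unmarked configuration. To this end the plane is cut into countably many cells of diameter
less than `δ`. Almost surely each contains at most one centre, and that centre is the barycentre of
the configuration in its cell. The occupied cells thus give a second enumeration of the centres
that is a measurable function of the configuration, and i.i.d. marks may be attached along either
enumeration without changing the law of the result (`lintegral_marks_eq_markedMean`).

The functionals involved integrate a function of the network over the points of the network itself,
and need not be measurable on the space of all measures. They are measurable along
enumerated configurations (`ConfigMeasurable`), which suffices before passing to the Palm
distribution, and on locally finite networks with at most one point at the origin, where the Palm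
distribution is concentrated (`ae_markedPalm_servedInCluster`).
-/

namespace D2D

noncomputable section

/-! ### Counting measures of sequences of points -/

/-- The counting measure of the points `z n` with `s n`. The index set `s` is arbitrary, unlike in
`configOf`, so that points may also be indexed by the cells of a partition that contain one. -/
def pointConfig {α : Type*} [MeasurableSpace α] (s : ℕ → Prop) (z : ℕ → α) : Measure α :=
  open Classical in Measure.sum fun n => if s n then Measure.dirac (z n) else 0

section PointConfig

variable {α β : Type*} [MeasurableSpace α] [MeasurableSpace β]

theorem configOf_eq_pointConfig (k : ℕ∞) (z : ℕ → α) :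
    configOf k z = pointConfig (fun n => (n : ℕ∞) < k) z := by
  unfold configOf pointConfig
  congr 1 with n : 1
  split_ifs <;> rfl

open Classical in
theorem lintegral_pointConfig {s : ℕ → Prop} {z : ℕ → α} {f : α → ℝ≥0∞} (hf : Measurable f) :
    ∫⁻ p, f p ∂(pointConfig s z) = ∑' n, if s n then f (z n) else 0 := by
  rw [pointConfig, lintegral_sum_measure]
  refine tsum_congr fun n => ?_
  split_ifs
  · exact lintegral_dirac' _ hf
  · simp

open Classical in
theorem lintegral_pointConfig_of_singleton [MeasurableSingletonClass α] {s : ℕ → Prop} {z : ℕ → α}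
    (f : α → ℝ≥0∞) : ∫⁻ p, f p ∂(pointConfig s z) = ∑' n, if s n then f (z n) else 0 := by
  rw [pointConfig, lintegral_sum_measure]
  refine tsum_congr fun n => ?_
  split_ifs <;> simp

open Classical in
theorem pointConfig_apply {s : ℕ → Prop} {z : ℕ → α} {A : Set α} (hA : MeasurableSet A) :
    pointConfig s z A = ∑' n, if s n then A.indicator 1 (z n) else 0 := by
  rw [← lintegral_indicator_one hA, lintegral_pointConfig (measurable_one.indicator hA)]

theorem pointConfig_congr {s : ℕ → Prop} {z z' : ℕ → α} (h : ∀ n, s n → z n = z' n) :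
    pointConfig s z = pointConfig s z' := by
  classical
  ext A hA
  rw [pointConfig_apply hA, pointConfig_apply hA]
  refine tsum_congr fun n => ?_
  split_ifs with hn
  · rw [h n hn]
  · rfl

theorem map_pointConfig {s : ℕ → Prop} {z : ℕ → α} {f : α → β} (hf : Measurable f) :
    (pointConfig s z).map f = pointConfig s fun n => f (z n) := by
  classical
  ext A hA
  rw [Measure.map_apply hf hA, pointConfig_apply (hf hA), pointConfig_apply hA]
  rfl

instance sFinite_pointConfig {s : ℕ → Prop} {z : ℕ → α} : SFinite (pointConfig s z) := by
  classical
  have (n : ℕ) : SFinite (if s n then Measure.dirac (z n) else 0) := by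
    split_ifs <;> infer_instance
  unfold pointConfig
  infer_instance

theorem measurable_pointConfig {s : β → ℕ → Prop} {z : β → ℕ → α}
    (hs : ∀ n, MeasurableSet {b | s b n}) (hz : ∀ n, Measurable fun b => z b n) :
    Measurable fun b => pointConfig (s b) (z b) := by
  classical
  refine Measure.measurable_of_measurable_coe _ fun A hA => ?_
  simp_rw [pointConfig_apply hA]
  exact Measurable.tsum fun n =>
    Measurable.ite (hs n) ((measurable_one.indicator hA).comp (hz n)) measurable_const

theorem ae_pointConfig {s : ℕ → Prop} {z : ℕ → α} {A : Set α} (hA : MeasurableSet A)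
    (h : ∀ n, s n → z n ∈ A) : ∀ᵐ p ∂(pointConfig s z), p ∈ A := by
  classical
  change pointConfig s z Aᶜ = 0
  rw [pointConfig_apply hA.compl, ENNReal.tsum_eq_zero]
  intro n
  split_ifs with hn
  · simp [h n hn]
  · rfl

/-- A configuration restricted to a set that contains exactly one of its points. -/
theorem pointConfig_restrict_eq_dirac {s : ℕ → Prop} {z : ℕ → α} {C : Set α}
    (hC : MeasurableSet C) {n : ℕ} (hn : s n) (hnC : z n ∈ C)
    (huniq : ∀ i, s i → z i ∈ C → i = n) :
    (pointConfig s z).restrict C = Measure.dirac (z n) := by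
  classical
  ext A hA
  rw [Measure.restrict_apply hA, pointConfig_apply (hA.inter hC), tsum_eq_single n,
    Measure.dirac_apply' _ hA]
  · by_cases h : z n ∈ A <;> simp [hn, hnC, h]
  · intro i hi
    split_ifs with hsi
    · exact Set.indicator_of_notMem (fun h => hi (huniq i hsi h.2)) _
    · rfl

end PointConfig

section SeenFrom

variable {𝓜 : Type*} [MeasurableSpace 𝓜]

theorem seenFrom_pointConfig (x : Plane) (s : ℕ → Prop) (z : ℕ → Plane × 𝓜) :
    seenFrom x (pointConfig s z) = pointConfig s fun n => ((z n).1 - x, (z n).2) :=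
  map_pointConfig (by fun_prop)

theorem measurable_seenFrom (φ : Network 𝓜) [SFinite φ] : Measurable fun x => seenFrom x φ := by
  refine Measure.measurable_of_measurable_coe _ fun A hA => ?_
  have h : Measurable fun q : Plane × (Plane × 𝓜) => (q.2.1 - q.1, q.2.2) := by fun_prop
  have h' (x : Plane) : seenFrom x φ A =
      φ (Prod.mk x ⁻¹' ((fun q : Plane × (Plane × 𝓜) => (q.2.1 - q.1, q.2.2)) ⁻¹' A)) := by
    rw [seenFrom, Measure.map_apply (by fun_prop) hA]
    rfl
  simp_rw [h']
  exact measurable_measure_prodMk_left (h hA)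

theorem seenFrom_apply (x : Plane) (φ : Network 𝓜) {A : Set (Plane × 𝓜)} (hA : MeasurableSet A) :
    seenFrom x φ A = φ {p | (p.1 - x, p.2) ∈ A} :=
  Measure.map_apply (by fun_prop) hA

theorem FinitePointsInBounded.seenFrom {φ : Network 𝓜} (h : FinitePointsInBounded φ) (x : Plane) :
    FinitePointsInBounded (seenFrom x φ) := by
  intro r
  rw [seenFrom_apply _ _ (measurableSet_closedBall.prod .univ)]
  refine (measure_mono ?_).trans_lt (h (r + ‖x‖))
  rintro ⟨y, m⟩ hp
  simp only [Set.mem_ofPred_eq, Set.mem_prod, mem_closedBall_zero_iff, Set.mem_univ,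
    and_true] at hp ⊢
  calc ‖y‖ = ‖(y - x) + x‖ := by rw [sub_add_cancel]
    _ ≤ ‖y - x‖ + ‖x‖ := norm_add_le _ _
    _ ≤ r + ‖x‖ := by gcongr

theorem finitePointsInBounded_iff_nat {φ : Network 𝓜} :
    FinitePointsInBounded φ ↔ ∀ n : ℕ, φ (Metric.closedBall (0 : Plane) n ×ˢ Set.univ) < ∞ := by
  refine ⟨fun h n => h n, fun h r => ?_⟩
  obtain ⟨n, hn⟩ := exists_nat_ge r
  exact (measure_mono (Set.prod_mono (Metric.closedBall_subset_closedBall hn) subset_rfl)).trans_lt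
    (h n)

theorem measurableSet_finitePointsInBounded :
    MeasurableSet {φ : Network 𝓜 | FinitePointsInBounded φ} := by
  simp_rw [finitePointsInBounded_iff_nat, Set.ofPred_forall]
  exact MeasurableSet.iInter fun n =>
    measurableSet_lt (Measure.measurable_coe (measurableSet_closedBall.prod .univ))
      measurable_const

end SeenFrom

/-! ### Independent marks and changes of enumeration -/

theorem infinitePi_map_comp_injective {𝓜 I : Type*} [MeasurableSpace 𝓜] (μ : Measure 𝓜)
    [IsProbabilityMeasure μ] {e : I → ℕ} (he : Function.Injective e) :
    (Measure.infinitePi fun _ : ℕ => μ).map (fun w i => w (e i)) =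
      Measure.infinitePi fun _ : I => μ := by
  classical
  refine Measure.eq_infinitePi _ fun s t ht => ?_
  rw [Measure.map_apply (by fun_prop) (.pi s.countable_toSet fun i _ => ht i)]
  have h : (fun (w : ℕ → 𝓜) (i : I) => w (e i)) ⁻¹' Set.pi s t =
      Set.pi (s.map ⟨e, he⟩ : Finset ℕ) fun n => ⋂ i, ⋂ _ : e i = n, t i := by
    ext w
    simp only [Set.mem_preimage, Set.mem_pi, Finset.mem_coe, Finset.mem_map,
      Function.Embedding.coeFn_mk, Set.mem_iInter]
    constructor
    · rintro hw n ⟨i, hi, rfl⟩ j hj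
      exact he hj ▸ hw i hi
    · exact fun hw i hi => hw (e i) ⟨i, hi, rfl⟩ i rfl
  have h' (i : I) : ⋂ j, ⋂ _ : e j = e i, t j = t i := by
    ext w
    simp only [Set.mem_iInter]
    exact ⟨fun hw => hw i rfl, fun hw j hj => he hj ▸ hw⟩
  rw [h, Measure.infinitePi_pi, Finset.prod_map]
  · simp [h']
  · intro n hn
    obtain ⟨i, -, rfl⟩ := Finset.mem_map.1 hn
    simpa [h'] using ht i

/-- The plane has a countable measurable partition into cells of diameter less than `δ`. -/
theorem exists_cell {δ : ℝ} (hδ : 0 < δ) :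
    ∃ c : Plane → ℕ, Measurable c ∧ ∀ x y, c x = c y → dist x y < δ := by
  classical
  have h (x : Plane) : ∃ n, dist x (TopologicalSpace.denseSeq Plane n) < δ / 2 := by
    obtain ⟨-, hy, n, rfl⟩ := Metric.dense_iff.1 (TopologicalSpace.denseRange_denseSeq Plane) x
      (δ / 2) (half_pos hδ)
    exact ⟨n, by rwa [dist_comm]⟩
  refine ⟨fun x => Nat.find (h x), measurable_find h fun n => ?_, fun x y hxy => ?_⟩
  · exact measurableSet_lt (by fun_prop) measurable_const
  · have hx := Nat.find_spec (h x)
    have hy := Nat.find_spec (h y)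
    simp only at hxy
    rw [← hxy] at hy
    calc dist x y ≤ _ := dist_triangle_right _ _ _
      _ < δ / 2 + δ / 2 := add_lt_add hx hy
      _ = δ := add_halves δ

/-- The barycentre of the restriction of `η` to the `j`-th cell of `c`: the position of its point in
that cell, if `η` has exactly one there. It is a measurable function of `η`. -/
def cellPoint (c : Plane → ℕ) (j : ℕ) (η : Measure Plane) : Plane :=
  WithLp.toLp 2 fun i => (∫⁻ x in c ⁻¹' {j}, ENNReal.ofReal (x i) ∂η).toReal -
    (∫⁻ x in c ⁻¹' {j}, ENNReal.ofReal (-x i) ∂η).toReal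

theorem measurable_cellPoint {c : Plane → ℕ} (hc : Measurable c) (j : ℕ) :
    Measurable (cellPoint c j) := by
  have hj : MeasurableSet (c ⁻¹' {j}) := hc (measurableSet_singleton j)
  have h {f : Plane → ℝ≥0∞} (hf : Measurable f) :
      Measurable fun η : Measure Plane => ∫⁻ x in c ⁻¹' {j}, f x ∂η := by
    simp_rw [← lintegral_indicator hj]
    exact Measure.measurable_lintegral (hf.indicator hj)
  refine (WithLp.measurable_toLp 2 _).comp (measurable_pi_lambda _ fun i => ?_)
  exact (h (by fun_prop)).ennreal_toReal.sub (h (by fun_prop)).ennreal_toReal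

section Cells

variable {c : Plane → ℕ} {s : ℕ → Prop} {a : ℕ → Plane}

theorem pointConfig_restrict_cell (hc : Measurable c)
    (hsep : ∀ i j, s i → s j → c (a i) = c (a j) → i = j) {n : ℕ} (hn : s n) :
    (pointConfig s a).restrict (c ⁻¹' {c (a n)}) = Measure.dirac (a n) :=
  pointConfig_restrict_eq_dirac (hc (measurableSet_singleton _)) hn rfl
    fun i hi h => hsep i n hi hn h

theorem cellPoint_pointConfig (hc : Measurable c)
    (hsep : ∀ i j, s i → s j → c (a i) = c (a j) → i = j) {n : ℕ} (hn : s n) :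
    cellPoint c (c (a n)) (pointConfig s a) = a n := by
  ext i
  simp only [cellPoint, pointConfig_restrict_cell hc hsep hn, lintegral_dirac]
  rcases le_total 0 (a n i) with h | h
  · simp [h, ENNReal.ofReal_of_nonpos (neg_nonpos.2 h)]
  · simp [h, ENNReal.ofReal_of_nonpos h]

theorem pointConfig_cell_ne_zero_iff (hc : Measurable c) {j : ℕ} :
    pointConfig s a (c ⁻¹' {j}) ≠ 0 ↔ ∃ n, s n ∧ c (a n) = j := by
  classical
  rw [pointConfig_apply (hc (measurableSet_singleton j)), Ne, ENNReal.tsum_eq_zero]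
  simp [Set.indicator_apply]

/-- A configuration with at most one point in each cell, marked by a function of the cell, can be
enumerated by its occupied cells. -/
theorem pointConfig_eq_cells {𝓜 : Type*} [MeasurableSpace 𝓜] (hc : Measurable c)
    (hsep : ∀ i j, s i → s j → c (a i) = c (a j) → i = j) (w : ℕ → 𝓜) :
    pointConfig s (fun n => (a n, w (c (a n)))) =
      pointConfig (fun j => pointConfig s a (c ⁻¹' {j}) ≠ 0)
        (fun j => (cellPoint c j (pointConfig s a), w j)) := by
  classical
  ext A hA
  rw [pointConfig_apply hA, pointConfig_apply hA]
  have he : Function.Injective fun n : {n // s n} => c (a n) :=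
    fun i j hij => Subtype.ext (hsep i j i.2 j.2 hij)
  rw [← (Subtype.val_injective (p := s)).tsum_eq]
  · rw [← he.tsum_eq]
    · refine tsum_congr fun n => ?_
      rw [if_pos n.2, if_pos ((pointConfig_cell_ne_zero_iff hc).2 ⟨n, n.2, rfl⟩),
        cellPoint_pointConfig hc hsep n.2]
    · intro j hj
      by_contra h
      refine hj (if_neg fun h' => h ?_)
      obtain ⟨n, hn, rfl⟩ := (pointConfig_cell_ne_zero_iff hc).1 h'
      exact ⟨⟨n, hn⟩, rfl⟩
  · intro n hn
    by_contra h
    exact hn (if_neg fun h' => h ⟨⟨n, h'⟩, rfl⟩)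

end Cells

/-- Measurability of a functional along enumerated configurations. The functionals of interest
integrate over the points of a network, and need not be measurable on the space of all measures. -/
def ConfigMeasurable {α : Type*} [MeasurableSpace α] (F : Measure α → ℝ≥0∞) : Prop :=
  Measurable fun q : (ℕ → Prop) × (ℕ → α) => F (pointConfig q.1 q.2)

theorem ConfigMeasurable.comp {α β : Type*} [MeasurableSpace α] [MeasurableSpace β]
    {F : Measure α → ℝ≥0∞} (hF : ConfigMeasurable F) {s : β → ℕ → Prop} {z : β → ℕ → α}
    (hs : ∀ n, MeasurableSet {b | s b n}) (hz : ∀ n, Measurable fun b => z b n) :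
    Measurable fun b => F (pointConfig (s b) (z b)) := by
  have hs' : Measurable s := measurable_pi_lambda _ fun n => measurableSet_setOfPred.1 (hs n)
  have hz' : Measurable z := measurable_pi_lambda _ hz
  have h : Measurable fun b => (s b, z b) := hs'.prodMk hz'
  exact Measurable.comp (g := fun q : (ℕ → Prop) × (ℕ → α) => F (pointConfig q.1 q.2))
    (f := fun b => (s b, z b)) hF h

/-- The mean of `F` over independent markings, with marks of law `μ`, of the configuration `η`,
whose points are enumerated by the cells of `c`. -/
def markedMean {𝓜 : Type*} [MeasurableSpace 𝓜] (c : Plane → ℕ) (μ : Measure 𝓜)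
    (F : Network 𝓜 → ℝ≥0∞) (η : Measure Plane) : ℝ≥0∞ :=
  ∫⁻ w, F (pointConfig (fun j => η (c ⁻¹' {j}) ≠ 0) fun j => (cellPoint c j η, w j))
    ∂(Measure.infinitePi fun _ : ℕ => μ)

section MarkedMean

variable {𝓜 : Type*} [MeasurableSpace 𝓜] {c : Plane → ℕ} {μ : Measure 𝓜} [IsProbabilityMeasure μ]
  {F : Network 𝓜 → ℝ≥0∞}

theorem measurable_markedMean (hc : Measurable c)
    (hF : ConfigMeasurable F) :
    Measurable (markedMean c μ F) := by
  refine Measurable.lintegral_prod_right' (f := fun p : Measure Plane × (ℕ → 𝓜) =>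
    F (pointConfig (fun j => p.1 (c ⁻¹' {j}) ≠ 0) fun j => (cellPoint c j p.1, p.2 j))) ?_
  refine hF.comp (fun j => MeasurableSet.compl ?_) (fun j => ?_)
  · exact ((Measure.measurable_coe (hc (measurableSet_singleton j))).comp measurable_fst)
      (measurableSet_singleton 0)
  · exact ((measurable_cellPoint hc j).comp measurable_fst).prodMk (by fun_prop)

/-- The mean over independent markings does not depend on the enumeration of the points. -/
theorem lintegral_marks_eq_markedMean (hc : Measurable c) {s : ℕ → Prop} {a : ℕ → Plane}
    (hsep : ∀ i j, s i → s j → c (a i) = c (a j) → i = j)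
    (hF : ConfigMeasurable F) :
    ∫⁻ w, F (pointConfig s fun n => (a n, w n)) ∂(Measure.infinitePi fun _ : ℕ => μ) =
      markedMean c μ F (pointConfig s a) := by
  classical
  obtain ⟨m₀⟩ : Nonempty 𝓜 := μ.nonempty_of_neZero
  -- The network as a function of the marks of the points that are present; both enumerations
  -- plug in i.i.d. marks along an injection.
  let G : ({n // s n} → 𝓜) → ℝ≥0∞ := fun w =>
    F (pointConfig s fun n => (a n, if h : s n then w ⟨n, h⟩ else m₀))
  have hG : Measurable G := by
    refine hF.comp (fun n => MeasurableSet.const _) fun n => ?_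
    refine measurable_const.prodMk ?_
    by_cases h : s n
    · simpa [h] using measurable_pi_apply _
    · simp [h]
  have key {e : {n // s n} → ℕ} (he : Function.Injective e) :
      ∫⁻ w, G (fun i => w (e i)) ∂(Measure.infinitePi fun _ : ℕ => μ) =
        ∫⁻ w, G w ∂(Measure.infinitePi fun _ : {n // s n} => μ) := by
    rw [← infinitePi_map_comp_injective μ he, lintegral_map hG (by fun_prop)]
  have he : Function.Injective fun n : {n // s n} => c (a n) :=
    fun i j hij => Subtype.ext (hsep i j i.2 j.2 hij)
  calc _ = ∫⁻ w, G (fun i => w i) ∂(Measure.infinitePi fun _ : ℕ => μ) := by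
        refine lintegral_congr fun w => congrArg F (pointConfig_congr fun n hn => ?_)
        simp [hn]
    _ = ∫⁻ w, G (fun i => w (c (a i))) ∂(Measure.infinitePi fun _ : ℕ => μ) := by
        rw [key Subtype.val_injective, key he]
    _ = _ := by
        refine lintegral_congr fun w => congrArg F ?_
        rw [← pointConfig_eq_cells hc hsep w]
        refine pointConfig_congr fun n hn => ?_
        simp [hn]

end MarkedMean

/-! ### Stationarity of the marked process -/

section MarkedProcess

variable {Ω : Type*} [MeasurableSpace Ω] {P : Measure Ω} {δ : ℝ} {lam : ℝ≥0}
  {Φp : ParentPP P δ lam} {𝓜 : Type*} [MeasurableSpace 𝓜] {μ : Measure 𝓜}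

theorem ParentPP.points_eq (Φp : ParentPP P δ lam) (ω : Ω) :
    Φp.points ω = pointConfig (fun n => (n : ℕ∞) < Φp.count ω) fun n => Φp.center n ω :=
  configOf_eq_pointConfig _ _

theorem ParentPP.measurableSet_lt_count (Φp : ParentPP P δ lam) (n : ℕ) :
    MeasurableSet {ω | (n : ℕ∞) < Φp.count ω} :=
  Φp.measurable_count (MeasurableSet.of_discrete (s := Set.Ioi (n : ℕ∞)))

theorem ParentPP.measurable_points (Φp : ParentPP P δ lam) : Measurable Φp.points := by
  rw [funext Φp.points_eq]
  exact measurable_pointConfig Φp.measurableSet_lt_count Φp.measurable_center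

namespace IndependentMarking

variable (Φ : IndependentMarking Φp μ)

theorem network_eq (ω : Ω) :
    Φ.network ω = pointConfig (fun n => (n : ℕ∞) < Φp.count ω)
      fun n => (Φp.center n ω, Φ.mark n ω) :=
  configOf_eq_pointConfig _ _

theorem sFinite_network (ω : Ω) : SFinite (Φ.network ω) := by
  rw [network_eq]
  infer_instance

theorem measurable_seenFrom_network (ω : Ω) :
    Measurable fun x => seenFrom x (Φ.network ω) :=
  have := Φ.sFinite_network ω
  measurable_seenFrom _

/-- The law of the translated network depends only on the law of the translated configuration of
centres. -/
theorem lintegral_translate_network [IsProbabilityMeasure P] {c : Plane → ℕ}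
    (hc : Measurable c) (hcδ : ∀ x y, c x = c y → dist x y < δ)
    {F : Network 𝓜 → ℝ≥0∞} (hF : ConfigMeasurable F) (v : Plane) :
    ∫⁻ ω, F (pointConfig (fun n => (n : ℕ∞) < Φp.count ω)
        fun n => (Φp.center n ω + v, Φ.mark n ω)) ∂P =
      ∫⁻ η, markedMean c μ F η ∂(P.map fun ω => (Φp.points ω).map fun x => x + v) := by
  have : IsProbabilityMeasure μ := by
    rw [← Φ.law 0]
    exact Measure.isProbabilityMeasure_map (Φ.measurable_mark 0).aemeasurable
  have hmark : Measurable fun ω n => Φ.mark n ω := measurable_pi_lambda _ Φ.measurable_mark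
  have hcenter : Measurable fun ω n => Φp.center n ω := measurable_pi_lambda _ Φp.measurable_center
  have hq : Measurable fun ω => (Φp.count ω, fun n => Φp.center n ω) :=
    Φp.measurable_count.prodMk hcenter
  have hlaw : P.map (fun ω n => Φ.mark n ω) = Measure.infinitePi fun _ : ℕ => μ := by
    rw [Φ.indep.map_fun_eq_infinitePi_map Φ.measurable_mark]
    simp_rw [Φ.law]
  have hjoint := (indepFun_iff_map_prod_eq_prod_map_map hq.aemeasurable hmark.aemeasurable).1
    Φ.indep_points.symm
  rw [hlaw] at hjoint
  let g : (ℕ∞ × (ℕ → Plane)) × (ℕ → 𝓜) → ℝ≥0∞ := fun r =>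
    F (pointConfig (fun n => (n : ℕ∞) < r.1.1) fun n => (r.1.2 n + v, r.2 n))
  have hg : Measurable g := by
    refine hF.comp (s := fun (r : (ℕ∞ × (ℕ → Plane)) × (ℕ → 𝓜)) n => (n : ℕ∞) < r.1.1)
      (z := fun r n => (r.1.2 n + v, r.2 n)) (fun n => ?_) fun n => by fun_prop
    exact (measurable_fst.comp measurable_fst)
      (MeasurableSet.of_discrete (s := Set.Ioi (n : ℕ∞)))
  have htr : Measurable fun η : Measure Plane => η.map fun x => x + v :=
    Measure.measurable_map _ (by fun_prop)
  calc _ = ∫⁻ r, g r ∂(P.map fun ω => ((Φp.count ω, fun n => Φp.center n ω),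
          fun n => Φ.mark n ω)) := (lintegral_map hg (hq.prodMk hmark)).symm
    _ = ∫⁻ ω, ∫⁻ w, g ((Φp.count ω, fun n => Φp.center n ω), w)
          ∂(Measure.infinitePi fun _ : ℕ => μ) ∂P := by
        rw [hjoint, lintegral_prod _ hg.aemeasurable, lintegral_map hg.lintegral_prod_right' hq]
    _ = ∫⁻ ω, markedMean c μ F ((Φp.points ω).map fun x => x + v) ∂P := by
        refine lintegral_congr_ae ?_
        filter_upwards [Φp.hardCore] with ω hω
        rw [Φp.points_eq, map_pointConfig (by fun_prop)]
        have hsep (i j : ℕ) (hi : (i : ℕ∞) < Φp.count ω) (hj : (j : ℕ∞) < Φp.count ω)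
            (hij : c (Φp.center i ω + v) = c (Φp.center j ω + v)) : i = j := by
          by_contra hne
          have h := hcδ _ _ hij
          rw [dist_add_right] at h
          exact (hω i j hi hj hne).not_gt h
        exact lintegral_marks_eq_markedMean (s := fun n => (n : ℕ∞) < Φp.count ω)
          (a := fun n => Φp.center n ω + v) hc hsep hF
    _ = _ := (lintegral_map (measurable_markedMean hc hF)
        (htr.comp Φp.measurable_points)).symm

/-- Stationarity of the marked process. -/
theorem lintegral_translate_network_eq [IsProbabilityMeasure P] (hδ : 0 < δ)
    {F : Network 𝓜 → ℝ≥0∞} (hF : ConfigMeasurable F) (v : Plane) :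
    ∫⁻ ω, F (pointConfig (fun n => (n : ℕ∞) < Φp.count ω)
        fun n => (Φp.center n ω + v, Φ.mark n ω)) ∂P = ∫⁻ ω, F (Φ.network ω) ∂P := by
  -- Both sides are integrals of the same functional of the configuration of centres.
  obtain ⟨c, hc, hcδ⟩ := exists_cell hδ
  have h := Φ.lintegral_translate_network hc hcδ hF 0
  simp only [add_zero, Measure.map_id'] at h
  simp_rw [network_eq]
  rw [Φ.lintegral_translate_network hc hcδ hF v, h]
  exact congrArg (fun ν => ∫⁻ η, markedMean c μ F η ∂ν) (Φp.stationary v)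

end IndependentMarking

/-! ### The Campbell measure and its disintegration -/

theorem configMeasurable_lintegral_seenFrom {h : Plane × 𝓜 × Network 𝓜 → ℝ≥0∞}
    (hh : Measurable h) :
    ConfigMeasurable fun φ : Network 𝓜 => ∫⁻ p, h (p.1, p.2, seenFrom p.1 φ) ∂φ := by
  classical
  have hpt (q : (ℕ → Prop) × (ℕ → Plane × 𝓜)) :
      ∫⁻ p, h (p.1, p.2, seenFrom p.1 (pointConfig q.1 q.2)) ∂(pointConfig q.1 q.2) =
        ∑' n, if q.1 n then h ((q.2 n).1, (q.2 n).2,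
          pointConfig q.1 fun k => ((q.2 k).1 - (q.2 n).1, (q.2 k).2)) else 0 := by
    have hm := measurable_seenFrom (pointConfig q.1 q.2)
    have hm' : Measurable fun p : Plane × 𝓜 =>
        h (p.1, p.2, seenFrom p.1 (pointConfig q.1 q.2)) :=
      hh.comp (measurable_fst.prodMk (measurable_snd.prodMk (hm.comp measurable_fst)))
    rw [lintegral_pointConfig hm']
    simp_rw [seenFrom_pointConfig]
  have hs (n : ℕ) : MeasurableSet {q : (ℕ → Prop) × (ℕ → Plane × 𝓜) | q.1 n} :=
    measurableSet_setOfPred.2 (by fun_prop)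
  unfold ConfigMeasurable
  simp_rw [hpt]
  refine Measurable.tsum fun n => Measurable.ite (hs n) (hh.comp ?_) measurable_const
  exact Measurable.prodMk (by fun_prop) (Measurable.prodMk (by fun_prop)
    (measurable_pointConfig hs fun k => by fun_prop))

/-- The Campbell measure of the network: the mean number of points `(x, m)` of the network for which
`x`, `m` and the network seen from `x` belong to a given set. -/
def campbell (Φ : IndependentMarking Φp μ) : Measure (Plane × 𝓜 × Network 𝓜) :=
  P.bind fun ω => (Φ.network ω).map fun p => (p.1, p.2, seenFrom p.1 (Φ.network ω))

/-- The Campbell measure of the centres in the unit square, with the location forgotten. Up to the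
factor `lam` it is the joint Palm distribution of the mark at the origin and of the network. -/
def markedPalm (Φ : IndependentMarking Φp μ) : Measure (𝓜 × Network 𝓜) :=
  ((campbell Φ).restrict (unitSquare ×ˢ Set.univ)).map Prod.snd

variable (Φ : IndependentMarking Φp μ)

theorem measurable_mark_seenFrom_network (ω : Ω) :
    Measurable fun p : Plane × 𝓜 => (p.1, p.2, seenFrom p.1 (Φ.network ω)) :=
  measurable_fst.prodMk (measurable_snd.prodMk
    ((Φ.measurable_seenFrom_network ω).comp measurable_fst))

theorem map_seenFrom_network (ω : Ω) :
    (Φ.network ω).map (fun p => (p.1, p.2, seenFrom p.1 (Φ.network ω))) =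
      pointConfig (fun n => (n : ℕ∞) < Φp.count ω) fun n => (Φp.center n ω, Φ.mark n ω,
        pointConfig (fun k => (k : ℕ∞) < Φp.count ω)
          fun k => (Φp.center k ω - Φp.center n ω, Φ.mark k ω)) := by
  have h := measurable_mark_seenFrom_network Φ ω
  rw [Φ.network_eq] at h ⊢
  rw [map_pointConfig h]
  simp_rw [seenFrom_pointConfig]

theorem measurable_map_seenFrom_network :
    Measurable fun ω => (Φ.network ω).map fun p => (p.1, p.2, seenFrom p.1 (Φ.network ω)) := by
  simp_rw [map_seenFrom_network]
  refine measurable_pointConfig Φp.measurableSet_lt_count fun n =>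
    (Φp.measurable_center n).prodMk ((Φ.measurable_mark n).prodMk
      (measurable_pointConfig Φp.measurableSet_lt_count fun k =>
        Measurable.prodMk ?_ (Φ.measurable_mark k)))
  exact (Φp.measurable_center k).sub (Φp.measurable_center n)

/-- Campbell's formula. -/
theorem lintegral_campbell {h : Plane × 𝓜 × Network 𝓜 → ℝ≥0∞} (hh : Measurable h) :
    ∫⁻ q, h q ∂(campbell Φ) =
      ∫⁻ ω, ∫⁻ p, h (p.1, p.2, seenFrom p.1 (Φ.network ω)) ∂(Φ.network ω) ∂P := by
  rw [campbell, Measure.lintegral_bind (measurable_map_seenFrom_network Φ).aemeasurable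
    hh.aemeasurable]
  exact lintegral_congr fun ω => lintegral_map hh (measurable_mark_seenFrom_network Φ ω)

theorem map_fst_network (ω : Ω) : (Φ.network ω).map Prod.fst = Φp.points ω := by
  rw [Φ.network_eq, Φp.points_eq, map_pointConfig measurable_fst]

theorem campbell_prod_univ {B : Set Plane} (hB : MeasurableSet B) :
    campbell Φ (B ×ˢ Set.univ) = ∫⁻ ω, Φp.points ω B ∂P := by
  rw [campbell, Measure.bind_apply (hB.prod .univ)
    (measurable_map_seenFrom_network Φ).aemeasurable]
  refine lintegral_congr fun ω => ?_
  rw [← map_fst_network Φ ω, Measure.map_apply measurable_fst hB,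
    Measure.map_apply (measurable_mark_seenFrom_network Φ ω) (hB.prod .univ)]
  congr 1
  ext p
  simp

theorem measurableSet_unitSquare : MeasurableSet unitSquare := by
  simp only [unitSquare, Set.ofPred_forall]
  exact MeasurableSet.iInter fun i => (by fun_prop : Measurable fun x : Plane => x i)
    measurableSet_Ico

theorem volume_unitSquare : volume unitSquare = 1 := by
  have h : unitSquare = WithLp.ofLp ⁻¹' (Set.univ.pi fun _ : Fin 2 => Set.Ico (0 : ℝ) 1) := by
    ext x
    simp [unitSquare]
  rw [h, (PiLp.volume_preserving_ofLp (Fin 2)).measure_preimage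
    (MeasurableSet.univ_pi fun _ => measurableSet_Ico).nullMeasurableSet, Real.volume_pi_Ico]
  simp

theorem interior_unitSquare_nonempty : (interior unitSquare).Nonempty := by
  refine ⟨WithLp.toLp 2 fun _ => 1 / 2, mem_interior.2
    ⟨{x | ∀ i, x i ∈ Set.Ioo (0 : ℝ) 1}, fun x hx i => Set.Ioo_subset_Ico_self (hx i), ?_, ?_⟩⟩
  · simp only [Set.ofPred_forall]
    exact isOpen_iInter_of_finite fun i =>
      isOpen_Ioo.preimage (by fun_prop : Continuous fun x : Plane => x i)
  · intro i
    norm_num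

theorem campbell_unitSquare : campbell Φ (unitSquare ×ˢ Set.univ) = lam := by
  rw [campbell_prod_univ Φ measurableSet_unitSquare]
  exact Φp.intensity

theorem markedPalm_apply {A : Set (𝓜 × Network 𝓜)} (hA : MeasurableSet A) :
    markedPalm Φ A = campbell Φ (unitSquare ×ˢ A) := by
  rw [markedPalm, Measure.map_apply measurable_snd hA,
    Measure.restrict_apply (measurable_snd hA)]
  congr 1
  ext p
  simp [and_comm]

theorem markedPalm_univ : markedPalm Φ Set.univ = lam := by
  rw [markedPalm_apply Φ .univ, campbell_unitSquare]

instance isFiniteMeasure_markedPalm : IsFiniteMeasure (markedPalm Φ) :=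
  ⟨by simp [markedPalm_univ]⟩

/-- Translating the whole network moves the locations, and leaves what is seen from each of them
unchanged. -/
theorem map_add_campbell [IsProbabilityMeasure P] (hδ : 0 < δ) (v : Plane) :
    (campbell Φ).map (fun q => (q.1 + v, q.2)) = campbell Φ := by
  refine Measure.ext_of_lintegral _ fun h hh => ?_
  have hv : Measurable fun q : Plane × 𝓜 × Network 𝓜 => (q.1 + v, q.2) := by fun_prop
  have hhv : Measurable fun q : Plane × 𝓜 × Network 𝓜 => h (q.1 + v, q.2) := hh.comp hv
  rw [lintegral_map hh hv, lintegral_campbell Φ hhv, lintegral_campbell Φ hh,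
    ← Φ.lintegral_translate_network_eq hδ (configMeasurable_lintegral_seenFrom hh) v]
  refine lintegral_congr fun ω => ?_
  have hshift : Measurable fun p : Plane × 𝓜 => (p.1 + v, p.2) := by fun_prop
  have hnet : pointConfig (fun n => (n : ℕ∞) < Φp.count ω)
      (fun n => (Φp.center n ω + v, Φ.mark n ω)) =
        (Φ.network ω).map fun p => (p.1 + v, p.2) := by
    rw [Φ.network_eq, map_pointConfig hshift]
  have hseen (x : Plane) : seenFrom (x + v) ((Φ.network ω).map fun p => (p.1 + v, p.2)) =
      seenFrom x (Φ.network ω) := by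
    rw [seenFrom, Measure.map_map (by fun_prop) hshift, seenFrom]
    congr 1
    ext p : 1
    simp
  have hm : Measurable fun p : Plane × 𝓜 => h (p.1, p.2,
      seenFrom p.1 ((Φ.network ω).map fun p => (p.1 + v, p.2))) := by
    rw [← hnet]
    exact hh.comp (measurable_fst.prodMk (measurable_snd.prodMk
      ((measurable_seenFrom _).comp measurable_fst)))
  rw [hnet, lintegral_map hm hshift]
  simp_rw [hseen]

/-- The Campbell measure is invariant under translations of the location, and is therefore the
product of Lebesgue measure and its value on the unit square. -/
theorem campbell_eq_prod [IsProbabilityMeasure P] (hδ : 0 < δ) :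
    campbell Φ = (volume : Measure Plane).prod (markedPalm Φ) := by
  refine (Measure.prod_eq fun B A hB hA => ?_).symm
  -- `ν` is translation invariant, hence a multiple of Lebesgue measure.
  let ν : Measure Plane := ((campbell Φ).restrict (Set.univ ×ˢ A)).map Prod.fst
  have hν {B : Set Plane} (hB : MeasurableSet B) : ν B = campbell Φ (B ×ˢ A) := by
    rw [Measure.map_apply measurable_fst hB, Measure.restrict_apply (measurable_fst hB)]
    congr 1
    ext p
    simp
  have : ν.IsAddLeftInvariant := by
    refine ⟨fun v => Measure.ext fun B hB => ?_⟩
    rw [Measure.map_apply (by fun_prop) hB, hν hB, hν (hB.preimage (by fun_prop))]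
    conv_rhs => rw [← map_add_campbell Φ hδ v]
    rw [Measure.map_apply (by fun_prop) (hB.prod hA)]
    congr 1
    ext p
    simp [add_comm]
  have hfin : ν (interior unitSquare) ≠ ∞ := by
    refine ne_top_of_le_ne_top (b := (lam : ℝ≥0∞)) ENNReal.coe_ne_top ?_
    rw [hν isOpen_interior.measurableSet, ← campbell_unitSquare Φ]
    exact measure_mono (Set.prod_mono interior_subset (Set.subset_univ _))
  have : IsFiniteMeasureOnCompacts ν :=
    ⟨fun K hK => measure_lt_top_of_isCompact_of_isAddLeftInvariant _ isOpen_interior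
      interior_unitSquare_nonempty hfin hK⟩
  obtain ⟨k, hk⟩ : ∃ k : ℝ≥0, ν = k • (volume : Measure Plane) :=
    ⟨_, Measure.isAddLeftInvariant_eq_smul ν volume⟩
  rw [markedPalm_apply Φ hA, ← hν hB, ← hν measurableSet_unitSquare, hk]
  simp only [Measure.smul_apply, volume_unitSquare, ENNReal.smul_def, smul_eq_mul, mul_one]
  exact mul_comm _ _

theorem lintegral_points [IsProbabilityMeasure P] (Φ : IndependentMarking Φp μ) (hδ : 0 < δ) {B : Set Plane}
    (hB : MeasurableSet B) : ∫⁻ ω, Φp.points ω B ∂P = lam * volume B := by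
  rw [← campbell_prod_univ Φ hB, campbell_eq_prod Φ hδ, Measure.prod_prod, markedPalm_univ,
    mul_comm]

theorem measurable_restrict_measure {α : Type*} [MeasurableSpace α] {A : Set α}
    (hA : MeasurableSet A) : Measurable fun η : Measure α => η.restrict A := by
  refine Measure.measurable_of_measurable_coe _ fun B hB => ?_
  simp_rw [Measure.restrict_apply hB]
  exact Measure.measurable_coe (hB.inter hA)

/-- The Palm distribution is the second marginal of `markedPalm`, normalised. -/
theorem palm_eq : palm P Φ.network lam = (lam : ℝ≥0∞)⁻¹ • (markedPalm Φ).map Prod.snd := by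
  rw [palm]
  congr 1
  have hQ : MeasurableSet (unitSquare ×ˢ (Set.univ : Set 𝓜)) := measurableSet_unitSquare.prod .univ
  have hmap (ω : Ω) : ((Φ.network ω).restrict (unitSquare ×ˢ Set.univ)).map
        (fun p => seenFrom p.1 (Φ.network ω)) =
      ((((Φ.network ω).map fun p => (p.1, p.2, seenFrom p.1 (Φ.network ω))).restrict
        (unitSquare ×ˢ Set.univ)).map Prod.snd).map Prod.snd := by
    have hm := measurable_mark_seenFrom_network Φ ω
    rw [Measure.map_map measurable_snd measurable_snd,
      Measure.restrict_map hm (measurableSet_unitSquare.prod .univ),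
      Measure.map_map (by fun_prop) hm]
    congr 2
  have hmeas : Measurable fun ω =>
      ((Φ.network ω).restrict (unitSquare ×ˢ Set.univ)).map
        fun p => seenFrom p.1 (Φ.network ω) := by
    simp_rw [hmap]
    exact (Measure.measurable_map _ measurable_snd).comp ((Measure.measurable_map _
      measurable_snd).comp ((measurable_restrict_measure
        (measurableSet_unitSquare.prod .univ)).comp (measurable_map_seenFrom_network Φ)))
  ext A hA
  have hA' : MeasurableSet ((Prod.snd : 𝓜 × Network 𝓜 → _) ⁻¹' A) := measurable_snd hA
  rw [Measure.bind_apply hA hmeas.aemeasurable, Measure.map_apply measurable_snd hA,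
    markedPalm_apply Φ hA', campbell, Measure.bind_apply (measurableSet_unitSquare.prod hA')
      (measurable_map_seenFrom_network Φ).aemeasurable]
  refine lintegral_congr fun ω => ?_
  rw [hmap, Measure.map_apply measurable_snd hA, Measure.map_apply measurable_snd hA',
    Measure.restrict_apply (measurable_snd hA')]
  congr 1
  ext p
  simp [and_comm]

/-- The mean number of centres in a ball is finite. -/
theorem ae_finitePointsInBounded [IsProbabilityMeasure P] (hδ : 0 < δ) :
    ∀ᵐ ω ∂P, FinitePointsInBounded (Φ.network ω) := by
  simp_rw [finitePointsInBounded_iff_nat, ae_all_iff]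
  intro n
  have hB : MeasurableSet (Metric.closedBall (0 : Plane) n) := measurableSet_closedBall
  have h : ∫⁻ ω, Φp.points ω (Metric.closedBall (0 : Plane) n) ∂P ≠ ∞ := by
    rw [lintegral_points Φ hδ hB]
    exact ENNReal.mul_ne_top ENNReal.coe_ne_top measure_closedBall_lt_top.ne
  filter_upwards [ae_lt_top ((Measure.measurable_coe hB).comp Φp.measurable_points) h] with ω hω
  refine lt_of_eq_of_lt ?_ hω
  rw [Function.comp_apply, ← map_fst_network Φ, Measure.map_apply measurable_fst hB]
  congr 1
  ext p
  simp

end MarkedProcess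

/-! ### Measurability of the number of served requests -/

section Sigma

variable {β : Type*} [MeasurableSpace β]

theorem measurableSet_sigma_fin {S : Set β} (hS : MeasurableSet S) (i : ℕ) :
    MeasurableSet {r : Σ n : ℕ, Fin n → β | ∃ h : i < r.1, r.2 ⟨i, h⟩ ∈ S} := by
  rw [MeasurableSpace.measurableSet_iInf]
  intro n
  change MeasurableSet {f : Fin n → β | ∃ h : i < n, f ⟨i, h⟩ ∈ S}
  by_cases h : i < n
  · have h' : {f : Fin n → β | ∃ h : i < n, f ⟨i, h⟩ ∈ S} = (fun f => f ⟨i, h⟩) ⁻¹' S := by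
      ext f
      simp [h]
    rw [h']
    exact measurable_pi_apply _ hS
  · simp [h]

theorem measurable_sigma_fin_getD {γ : Type*} [MeasurableSpace γ] {g : β → γ} (hg : Measurable g)
    (i : ℕ) (b : γ) :
    Measurable fun r : Σ n : ℕ, Fin n → β => if h : i < r.1 then g (r.2 ⟨i, h⟩) else b := by
  intro S hS
  rw [MeasurableSpace.measurableSet_iInf]
  intro n
  change MeasurableSet {f : Fin n → β | (if h : i < n then g (f ⟨i, h⟩) else b) ∈ S}
  by_cases h : i < n
  · have h' : {f : Fin n → β | (if h : i < n then g (f ⟨i, h⟩) else b) ∈ S} =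
        (fun f => g (f ⟨i, h⟩)) ⁻¹' S := by
      ext f
      simp [h]
    rw [h']
    exact (hg.comp (measurable_pi_apply _)) hS
  · simp [h]

end Sigma

section Strategy

variable {M L : ℕ} {ι : Type*}

theorem measurableSet_matched (i : ℕ) :
    MeasurableSet {m : Mark M L ι | ∃ h : i < numReq m, Matched m ⟨i, h⟩} := by
  have hreq (v : Fin L) :
      MeasurableSet {m : Mark M L ι | ∃ h : i < numReq m, reqVideo m ⟨i, h⟩ = v} := by
    have hr : Measurable fun m : Mark M L ι => m.1.1.2 := by fun_prop
    exact hr (measurableSet_sigma_fin (β := Plane × Fin L)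
      (measurable_snd (measurableSet_singleton v)) i)
  have hcache (j : ℕ) (k : Fin M) (v : Fin L) :
      MeasurableSet {m : Mark M L ι | ∃ h : j < numCache m, cached m ⟨j, h⟩ k = v} := by
    have hr : Measurable fun m : Mark M L ι => m.1.1.1 := by fun_prop
    exact hr (measurableSet_sigma_fin (β := Plane × (Fin M → Fin L))
      (((measurable_pi_apply k).comp measurable_snd) (measurableSet_singleton v)) j)
  have h : {m : Mark M L ι | ∃ h : i < numReq m, Matched m ⟨i, h⟩} =
      ⋃ v : Fin L, ⋃ j : ℕ, ⋃ k : Fin M,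
        {m : Mark M L ι | ∃ h : i < numReq m, reqVideo m ⟨i, h⟩ = v} ∩
          {m : Mark M L ι | ∃ h : j < numCache m, cached m ⟨j, h⟩ k = v} := by
    ext m
    simp only [Set.mem_iUnion]
    constructor
    · rintro ⟨h, j, k, hjk⟩
      exact ⟨_, j, k, ⟨h, rfl⟩, j.2, hjk⟩
    · rintro ⟨v, j, k, ⟨h, hv⟩, hj, hjk⟩
      exact ⟨h, ⟨j, hj⟩, k, hjk.trans hv.symm⟩
  rw [h]
  exact MeasurableSet.iUnion fun v => MeasurableSet.iUnion fun j => MeasurableSet.iUnion fun k =>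
    (hreq v).inter (hcache j k v)

/-- The number of served requests in `K` of a cluster centred at `x` with mark `m`, from whose
centre the network is seen as `φ`. It is set to `0` if `φ` is not locally finite, as strategies are
only measurable on locally finite networks. -/
def servedCount (F : InClusterStrategy M L ι) (R : ℝ≥0) (K : Set Plane) (x : Plane)
    (m : Mark M L ι) (φ : Network (Mark M L ι)) : ℝ≥0∞ :=
  open Classical in
  if FinitePointsInBounded φ then
    ∑ i : Fin (numReq m), if x + reqPos m i ∈ K ∧ Served F R m φ i then 1 else 0
  else 0

variable (F : InClusterStrategy M L ι) (R : ℝ≥0)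

theorem measurable_servedCount {K : Set Plane} (hK : MeasurableSet K) :
    Measurable fun q : Plane × Mark M L ι × Network (Mark M L ι) =>
      servedCount F R K q.1 q.2.1 q.2.2 := by
  classical
  let S (i : ℕ) : Set (Plane × Mark M L ι × Network (Mark M L ι)) :=
    {q | FinitePointsInBounded q.2.2 ∧ ∃ h : i < numReq q.2.1,
      q.1 + reqPos q.2.1 ⟨i, h⟩ ∈ K ∧ Served F R q.2.1 q.2.2 ⟨i, h⟩}
  let pos (i : ℕ) (m : Mark M L ι) : Plane := if h : i < numReq m then reqPos m ⟨i, h⟩ else 0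
  have hpos (i : ℕ) : Measurable (pos i) := by
    have hr : Measurable fun m : Mark M L ι => m.1.1.2 := by fun_prop
    exact (measurable_sigma_fin_getD (β := Plane × Fin L) measurable_fst i 0).comp hr
  have hmark : Measurable fun q : Plane × Mark M L ι × Network (Mark M L ι) => q.2.1 := by fun_prop
  have hS (i : ℕ) : MeasurableSet (S i) := by
    have h : S i = {q | q.1 + pos i q.2.1 ∈ K} ∩
        ((fun q => q.2.1) ⁻¹' {m | ∃ h : i < numReq m, Matched m ⟨i, h⟩}) ∩
        ((fun q => q.2.1) ⁻¹' {m | ∃ h : i < numReq m, (⟨i, h⟩ : Fin (numReq m)) ∈ F.scheduled m}) ∩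
        (Prod.snd ⁻¹' {q | FinitePointsInBounded q.2 ∧
          ∃ h : i < numReq q.1, RateIn (F.region q.1 q.2) ⟨i, h⟩ R}) := by
      ext q
      constructor
      · rintro ⟨hfin, h, hK, hm, hs, hr⟩
        refine ⟨⟨⟨?_, h, hm⟩, h, hs⟩, hfin, h, hr⟩
        change q.1 + pos i q.2.1 ∈ K
        simpa only [pos, dif_pos h] using hK
      · rintro ⟨⟨⟨hK, h, hm⟩, _, hs⟩, hfin, _, hr⟩
        refine ⟨hfin, h, ?_, hm, hs, hr⟩
        change q.1 + pos i q.2.1 ∈ K at hK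
        simpa only [pos, dif_pos h] using hK
    rw [h]
    exact ((((measurable_fst.add ((hpos i).comp hmark)) hK).inter
      (hmark (measurableSet_matched i))).inter (hmark (F.measurable_scheduled i))).inter
        (measurable_snd (F.measurable_region i R))
  have h (q : Plane × Mark M L ι × Network (Mark M L ι)) :
      servedCount F R K q.1 q.2.1 q.2.2 = ∑' i, if q ∈ S i then 1 else 0 := by
    rw [servedCount]
    split_ifs with hq
    · rw [Finset.sum_fin_eq_sum_range, tsum_eq_sum (s := Finset.range (numReq q.2.1))]
      · refine Finset.sum_congr rfl fun i hi => ?_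
        have hi' := Finset.mem_range.1 hi
        simp [S, hq, hi']
      · intro i hi
        have hi' : ¬ i < numReq q.2.1 := fun h => hi (Finset.mem_range.2 h)
        simp [S, hi']
    · simp [S, hq]
  simp_rw [h]
  exact Measurable.tsum fun i => Measurable.ite (hS i) measurable_const measurable_const

/-- Averaging over the location of the cluster centre removes the dependence on the positions of
the users relative to it. -/
theorem lintegral_servedCount {K : Set Plane} (hK : MeasurableSet K) (m : Mark M L ι)
    (φ : Network (Mark M L ι)) :
    ∫⁻ x, servedCount F R K x m φ = volume K * servedCount F R Set.univ 0 m φ := by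
  classical
  simp only [servedCount]
  split_ifs
  · have hm (i : Fin (numReq m)) : MeasurableSet {x : Plane | x + reqPos m i ∈ K} :=
      (measurable_add_const (reqPos m i)) hK
    rw [lintegral_finsetSum', Finset.mul_sum]
    · refine Finset.sum_congr rfl fun i _ => ?_
      by_cases hi : Served F R m φ i
      · have h (x : Plane) : (if x + reqPos m i ∈ K ∧ Served F R m φ i then (1 : ℝ≥0∞) else 0) =
            ((· + reqPos m i) ⁻¹' K).indicator 1 x := by
          simp [hi, Set.indicator_apply]
        simp_rw [h]
        rw [lintegral_indicator_one (measurable_add_const (reqPos m i) hK),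
          measure_preimage_add_right]
        simp [hi]
      · simp [hi]
    · intro i _
      by_cases hi : Served F R m φ i
      · simpa [hi] using
          (Measurable.ite (hm i) measurable_const measurable_const).aemeasurable
      · simp [hi]
  · simp

theorem servedIn_eq {K : Set Plane} {φ : Network (Mark M L ι)} (hφ : FinitePointsInBounded φ) :
    servedIn F R K φ = ∫⁻ p, servedCount F R K p.1 p.2 (seenFrom p.1 φ) ∂φ := by
  classical
  refine lintegral_congr fun p => ?_
  rw [servedCount, if_pos (hφ.seenFrom p.1)]

theorem servedInCluster_eq {x : Plane} {φ : Network (Mark M L ι)} (hφ : FinitePointsInBounded φ) :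
    servedInCluster F R x φ =
      ∫⁻ p in {x} ×ˢ Set.univ, servedCount F R Set.univ 0 p.2 (seenFrom x φ) ∂φ := by
  classical
  refine lintegral_congr fun p => ?_
  rw [servedCount, if_pos (hφ.seenFrom x)]
  simp

theorem servedInCluster_eq_servedCount {x : Plane} {m : Mark M L ι} {φ : Network (Mark M L ι)}
    (hφ : FinitePointsInBounded φ) (h : φ.restrict ({x} ×ˢ Set.univ) = Measure.dirac (x, m)) :
    servedInCluster F R x φ = servedCount F R Set.univ 0 m (seenFrom x φ) := by
  rw [servedInCluster_eq F R hφ, h, lintegral_dirac']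
  exact (measurable_servedCount F R .univ).comp
    (measurable_const.prodMk (measurable_snd.prodMk measurable_const))

theorem seenFrom_zero {𝓜 : Type*} [MeasurableSpace 𝓜] (φ : Network 𝓜) : seenFrom 0 φ = φ := by
  simp [seenFrom]

/-- The locally finite networks with at most one point at the origin. -/
def simpleAtOrigin (𝓜 : Type*) [MeasurableSpace 𝓜] : Set (Network 𝓜) :=
  {φ | FinitePointsInBounded φ ∧ φ ({0} ×ˢ Set.univ) ≤ 1}

theorem measurableSet_simpleAtOrigin {𝓜 : Type*} [MeasurableSpace 𝓜] :
    MeasurableSet (simpleAtOrigin 𝓜) :=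
  measurableSet_finitePointsInBounded.inter (measurableSet_le
    (Measure.measurable_coe ((measurableSet_singleton 0).prod .univ)) measurable_const)

open Classical in
/-- The bound on the mass at the origin makes the restriction of a network to the origin a finite
kernel, against which jointly measurable functions can be integrated measurably. -/
theorem measurable_servedInCluster_indicator :
    Measurable ((simpleAtOrigin (Mark M L ι)).indicator fun φ => servedInCluster F R 0 φ) := by
  have h0 : MeasurableSet (({0} : Set Plane) ×ˢ (Set.univ : Set (Mark M L ι))) :=
    (measurableSet_singleton 0).prod .univ
  let κ : Kernel (Network (Mark M L ι)) (Plane × Mark M L ι) :=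
    ⟨fun φ => if φ ∈ simpleAtOrigin (Mark M L ι) then φ.restrict ({0} ×ˢ Set.univ) else 0,
      Measurable.ite measurableSet_simpleAtOrigin (measurable_restrict_measure h0)
        measurable_const⟩
  have hκ (φ : Network (Mark M L ι)) : κ φ =
      if φ ∈ simpleAtOrigin (Mark M L ι) then φ.restrict ({0} ×ˢ Set.univ) else 0 := rfl
  have : IsFiniteKernel κ := by
    refine ⟨1, ENNReal.one_lt_top, fun φ => ?_⟩
    rw [hκ]
    split_ifs with h
    · simpa using h.2
    · simp
  have h (φ : Network (Mark M L ι)) :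
      (simpleAtOrigin (Mark M L ι)).indicator (fun φ => servedInCluster F R 0 φ) φ =
        ∫⁻ p, servedCount F R Set.univ 0 p.2 φ ∂(κ φ) := by
    rw [hκ]
    split_ifs with hφ
    · rw [Set.indicator_of_mem hφ, servedInCluster_eq F R hφ.1, seenFrom_zero]
    · simp [hφ]
  have hm : Measurable fun r : Network (Mark M L ι) × (Plane × Mark M L ι) =>
      servedCount F R Set.univ 0 r.2.2 r.1 :=
    Measurable.comp (g := fun q : Plane × Mark M L ι × Network (Mark M L ι) =>
      servedCount F R Set.univ q.1 q.2.1 q.2.2)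
      (f := fun r : Network (Mark M L ι) × (Plane × Mark M L ι) => (0, r.2.2, r.1))
      (measurable_servedCount F R .univ) (by fun_prop)
  rw [funext h]
  exact hm.lintegral_kernel_prod_right'

end Strategy

/-! ### Means of the numbers of served requests -/

section MarkedProcess

variable {Ω : Type*} [MeasurableSpace Ω] {P : Measure Ω} {δ : ℝ} {lam : ℝ≥0}
  {Φp : ParentPP P δ lam} {𝓜 : Type*} [MeasurableSpace 𝓜]

/-- To prove that a property holds almost everywhere for the Campbell measure, it is enough to check
it at each point of the network. -/
theorem ae_campbell {μ : Measure 𝓜} (Φ : IndependentMarking Φp μ)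
    {S : Set (Plane × 𝓜 × Network 𝓜)} (hS : MeasurableSet S)
    (h : ∀ᵐ ω ∂P, ∀ n : ℕ, (n : ℕ∞) < Φp.count ω →
      (Φp.center n ω, Φ.mark n ω, seenFrom (Φp.center n ω) (Φ.network ω)) ∈ S) :
    ∀ᵐ q ∂(campbell Φ), q ∈ S := by
  change campbell Φ Sᶜ = 0
  rw [campbell, Measure.bind_apply hS.compl (measurable_map_seenFrom_network Φ).aemeasurable]
  refine (lintegral_congr_ae ?_).trans lintegral_zero
  filter_upwards [h] with ω hω
  rw [map_seenFrom_network]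
  refine ae_pointConfig hS fun n hn => ?_
  have h := hω n hn
  rwa [Φ.network_eq, seenFrom_pointConfig] at h

/-- By the hard-core property, each centre carries exactly one point of the network. -/
theorem ae_network_restrict_center {μ : Measure 𝓜} (Φ : IndependentMarking Φp μ) (hδ : 0 < δ) :
    ∀ᵐ ω ∂P, ∀ n : ℕ, (n : ℕ∞) < Φp.count ω →
      (Φ.network ω).restrict ({Φp.center n ω} ×ˢ Set.univ) =
        Measure.dirac (Φp.center n ω, Φ.mark n ω) := by
  filter_upwards [Φp.hardCore] with ω hω n hn
  rw [Φ.network_eq]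
  refine pointConfig_restrict_eq_dirac (s := fun n => (n : ℕ∞) < Φp.count ω)
    (z := fun n => (Φp.center n ω, Φ.mark n ω)) ((measurableSet_singleton _).prod .univ) hn
    (by simp) fun i hi h => ?_
  by_contra hne
  have h' : Φp.center i ω = Φp.center n ω := h.1
  have := hω i n hi hn hne
  rw [h', dist_self] at this
  exact this.not_gt hδ

theorem seenFrom_restrict_origin {x : Plane} {m : 𝓜} {φ : Network 𝓜}
    (h : φ.restrict ({x} ×ˢ Set.univ) = Measure.dirac (x, m)) :
    (seenFrom x φ).restrict ({0} ×ˢ Set.univ) = Measure.dirac ((0 : Plane), m) := by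
  have hm : Measurable fun p : Plane × 𝓜 => (p.1 - x, p.2) := by fun_prop
  have hpre : (fun p : Plane × 𝓜 => (p.1 - x, p.2)) ⁻¹' ({0} ×ˢ Set.univ) = {x} ×ˢ Set.univ := by
    ext p
    simp [sub_eq_zero]
  rw [seenFrom, Measure.restrict_map hm ((measurableSet_singleton 0).prod .univ), hpre, h,
    Measure.map_dirac' hm, sub_self]

variable {M L : ℕ} {ι : Type*} {μ : Measure (Mark M L ι)} (Φ : IndependentMarking Φp μ)
  (F : InClusterStrategy M L ι) (R : ℝ≥0)

/-- Under the Palm distribution, the cluster at the origin is the one of the distinguished mark. -/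
theorem ae_markedPalm_servedInCluster [IsProbabilityMeasure P] (hδ : 0 < δ) :
    ∀ᵐ r ∂(markedPalm Φ), r.2 ∈ simpleAtOrigin (Mark M L ι) ∧
      (simpleAtOrigin (Mark M L ι)).indicator (fun φ => servedInCluster F R 0 φ) r.2 =
        servedCount F R Set.univ 0 r.1 r.2 := by
  have hS : MeasurableSet {r : Mark M L ι × Network (Mark M L ι) |
      r.2 ∈ simpleAtOrigin (Mark M L ι) ∧
      (simpleAtOrigin (Mark M L ι)).indicator (fun φ => servedInCluster F R 0 φ) r.2 =
        servedCount F R Set.univ 0 r.1 r.2} :=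
    (measurable_snd measurableSet_simpleAtOrigin).inter (measurableSet_eq_fun
      ((measurable_servedInCluster_indicator F R).comp measurable_snd)
      ((measurable_servedCount F R .univ).comp (measurable_const.prodMk measurable_id)))
  refine (ae_map_iff measurable_snd.aemeasurable hS).2 (ae_restrict_of_ae ?_)
  refine ae_campbell Φ (measurable_snd hS) ?_
  filter_upwards [ae_network_restrict_center Φ hδ, ae_finitePointsInBounded Φ hδ]
    with ω hω hfin n hn
  have hfin' := hfin.seenFrom (Φp.center n ω)
  have h0 := seenFrom_restrict_origin (hω n hn)
  have hmem : seenFrom (Φp.center n ω) (Φ.network ω) ∈ simpleAtOrigin (Mark M L ι) := by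
    refine ⟨hfin', ?_⟩
    rw [← Measure.restrict_apply_univ, h0]
    simp
  refine ⟨hmem, ?_⟩
  simp only
  rw [Set.indicator_of_mem hmem, servedInCluster_eq_servedCount F R hfin' h0, seenFrom_zero]

theorem lintegral_palm_servedInCluster [IsProbabilityMeasure P] (hδ : 0 < δ) :
    ∫⁻ φ, servedInCluster F R 0 φ ∂(palm P Φ.network lam) =
      (lam : ℝ≥0∞)⁻¹ * ∫⁻ r, servedCount F R Set.univ 0 r.1 r.2 ∂(markedPalm Φ) := by
  have hae := ae_markedPalm_servedInCluster Φ F R hδ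
  rw [palm_eq, lintegral_smul_measure, smul_eq_mul]
  congr 1
  calc _ = ∫⁻ φ, (simpleAtOrigin (Mark M L ι)).indicator (fun φ => servedInCluster F R 0 φ) φ
        ∂((markedPalm Φ).map Prod.snd) := by
        refine lintegral_congr_ae ?_
        have h : ∀ᵐ φ ∂((markedPalm Φ).map Prod.snd), φ ∈ simpleAtOrigin (Mark M L ι) :=
          (ae_map_iff measurable_snd.aemeasurable measurableSet_simpleAtOrigin).2
            (hae.mono fun r hr => hr.1)
        filter_upwards [h] with φ hφ
        rw [Set.indicator_of_mem hφ]
    _ = _ := by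
        rw [lintegral_map (measurable_servedInCluster_indicator F R) measurable_snd]
        exact lintegral_congr_ae (hae.mono fun r hr => hr.2)

theorem lintegral_servedIn [IsProbabilityMeasure P] (hδ : 0 < δ) {K : Set Plane}
    (hK : MeasurableSet K) :
    ∫⁻ ω, servedIn F R K (Φ.network ω) ∂P =
      volume K * ∫⁻ r, servedCount F R Set.univ 0 r.1 r.2 ∂(markedPalm Φ) := by
  have hm := measurable_servedCount F R hK
  have hm0 : Measurable fun r : Mark M L ι × Network (Mark M L ι) =>
      servedCount F R Set.univ 0 r.1 r.2 :=
    (measurable_servedCount F R .univ).comp (measurable_const.prodMk measurable_id)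
  calc _ = ∫⁻ q, servedCount F R K q.1 q.2.1 q.2.2 ∂(campbell Φ) := by
        rw [lintegral_campbell Φ hm]
        refine lintegral_congr_ae ?_
        filter_upwards [ae_finitePointsInBounded Φ hδ] with ω hω
        exact servedIn_eq F R hω
    _ = _ := by
        rw [campbell_eq_prod Φ hδ, lintegral_prod_symm' _ hm, ← lintegral_const_mul _ hm0]
        exact lintegral_congr fun r => lintegral_servedCount F R hK r.1 r.2

theorem lintegral_servedInCluster_points [IsProbabilityMeasure P] (hδ : 0 < δ) {B : Set Plane}
    (hB : MeasurableSet B) :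
    ∫⁻ ω, ∫⁻ x in B, servedInCluster F R x (Φ.network ω) ∂(Φp.points ω) ∂P =
      volume B * ∫⁻ r, servedCount F R Set.univ 0 r.1 r.2 ∂(markedPalm Φ) := by
  classical
  have hm0 : Measurable fun r : Mark M L ι × Network (Mark M L ι) =>
      servedCount F R Set.univ 0 r.1 r.2 :=
    (measurable_servedCount F R .univ).comp (measurable_const.prodMk measurable_id)
  have hm1 : Measurable (B.indicator (1 : Plane → ℝ≥0∞)) := measurable_one.indicator hB
  have hm : Measurable fun q : Plane × Mark M L ι × Network (Mark M L ι) =>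
      B.indicator 1 q.1 * servedCount F R Set.univ 0 q.2.1 q.2.2 :=
    (hm1.comp measurable_fst).mul (hm0.comp measurable_snd)
  calc _ = ∫⁻ q, B.indicator 1 q.1 * servedCount F R Set.univ 0 q.2.1 q.2.2 ∂(campbell Φ) := by
        rw [lintegral_campbell Φ hm]
        refine lintegral_congr_ae ?_
        filter_upwards [ae_network_restrict_center Φ hδ, ae_finitePointsInBounded Φ hδ]
          with ω hω hfin
        have hmω := hm.comp (measurable_mark_seenFrom_network Φ ω)
        have hsum := lintegral_pointConfig (s := fun n => (n : ℕ∞) < Φp.count ω)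
          (z := fun n => (Φp.center n ω, Φ.mark n ω)) hmω
        rw [← Φ.network_eq] at hsum
        refine Eq.trans ?_ hsum.symm
        rw [← lintegral_indicator hB, Φp.points_eq, lintegral_pointConfig_of_singleton]
        refine tsum_congr fun n => ?_
        split_ifs with hn
        · by_cases hx : Φp.center n ω ∈ B
          · simp [hx, servedInCluster_eq_servedCount F R hfin (hω n hn)]
          · simp [hx]
        · rfl
    _ = _ := by
        rw [campbell_eq_prod Φ hδ, lintegral_prod_mul hm1.aemeasurable hm0.aemeasurable,
          lintegral_indicator_one hB]

end MarkedProcess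

end

end D2D

theorem lemma1 {Ω : Type*} [MeasurableSpace Ω] (P : Measure Ω) [IsProbabilityMeasure P]
    {M L : ℕ} {ι : Type*} (lamU lamR Rc : ℝ≥0) (hRc : 0 < Rc) (pA pV : PMF (Fin L))
    (fading : Kernel D2D.Positions (ι → ℝ≥0)) [IsMarkovKernel fading]
    (δ : ℝ) (hδ : 2 * (Rc : ℝ) ≤ δ) (lam : ℝ≥0) (Φp : D2D.ParentPP P δ lam)
    (Φ : D2D.IndependentMarking Φp
      (D2D.markLaw lamU lamR Rc pA pV fading : Measure (D2D.Mark M L ι)))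
    (F : D2D.InClusterStrategy M L ι) (R : ℝ≥0) :
    (∀ K : Set D2D.Plane, IsCompact K →
      ∫⁻ ω, D2D.servedIn F R K (Φ.network ω) ∂P =
        lam * volume K *
          ∫⁻ φ, D2D.servedInCluster F R 0 φ ∂(D2D.palm P Φ.network lam)) ∧
    (∀ B : Set D2D.Plane, MeasurableSet B → volume B ≠ 0 → volume B ≠ ∞ →
      (∫⁻ ω, ∫⁻ x in B, D2D.servedInCluster F R x (Φ.network ω) ∂(Φp.points ω) ∂P) /
          ∫⁻ ω, Φp.points ω B ∂P =
        ∫⁻ φ, D2D.servedInCluster F R 0 φ ∂(D2D.palm P Φ.network lam)) := by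
  have hδ0 : 0 < δ := lt_of_lt_of_le (by positivity) hδ
  have hlam : (lam : ℝ≥0∞) ≠ 0 := ENNReal.coe_ne_zero.2 Φp.intensity_pos.ne'
  refine ⟨fun K hK => ?_, fun B hB hB0 hB' => ?_⟩
  · rw [D2D.lintegral_servedIn Φ F R hδ0 hK.measurableSet,
      D2D.lintegral_palm_servedInCluster Φ F R hδ0, mul_comm (lam : ℝ≥0∞), mul_assoc,
      ← mul_assoc (lam : ℝ≥0∞), ENNReal.mul_inv_cancel hlam ENNReal.coe_ne_top, one_mul]
  · rw [D2D.lintegral_servedInCluster_points Φ F R hδ0 hB, D2D.lintegral_points Φ hδ0 hB,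
      D2D.lintegral_palm_servedInCluster Φ F R hδ0, mul_comm (lam : ℝ≥0∞),
      ENNReal.mul_div_mul_left _ _ hB0 hB', ENNReal.div_eq_inv_mul]
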